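/- **Setting.** Let $\mathcal S$ be a compact metric space and $(\Omega,\mathcal F,\mathbb P)$ a probability space. For $B\subseteq\Omega$ let $\mathbb P^*[B]=\inf\{\mathbb P[A]:A\supseteq B,\ A\in\mathcal F\}$ and $\mathbb P_*[B]=1-\mathbb P^*[\Omega\setminus B]$. Let $\gamma^1,\gamma^2:\mathcal S\to\mathbb R$ be continuous, let $\hat\gamma^1_n,\hat\gamma^2_n:\Omega\to\ell^\infty(\mathcal S)$ be arbitrary maps, let $\tau_n>0$ with $\tau_n\to0$, and let $J^1,J^2:\Omega\to C(\mathcal S,\mathbb R)$ be random processes such that, jointly in $i\in\{1,2\}$, $$\hat J^i_n:=\tau_n^{-1}(\hat\gamma^i_n-\gamma^i)\xrightarrow{d}J^i\quad\text{in }\ell^\infty(\mathcal S)^2,$$ where $\xrightarrow{d}$ is weak convergence in the sense of Hoffmann-Jørgensen (the limit is Borel measurable, and the outer expectations of every bounded continuous function converge). For reals (and pointwise for functions) put $a\,\Delta\,b:=\max(\min(-a,b),\min(a,-b))$, and let $\mu:=\gamma^1\Delta\gamma^2$. For $\kappa\in\mathcal I:=\{-1,0,1\}^2$ let $$V_\kappa:=\{s:\operatorname{sgn}(\gamma^1(s)-\gamma^2(s))=\kappa_1,\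 \operatorname{sgn}(\gamma^1(s)+\gamma^2(s))=\kappa_2\},\qquad \mathcal N:=\bigcup_{\kappa\in\{-1,1\}^2}V_{(0,0)}\cap\overline{V_\kappa},$$ and let $H(s)$ be $-J^1(s)$, $-J^2(s)$, $J^1(s)$, $J^2(s)$, $\max(J^1,J^2)(s)$, $\min(-J^1,J^2)(s)$, $\min(J^1,-J^2)(s)$, $\max(-J^1,-J^2)(s)$, $(J^1\Delta J^2)(s)$ for $s$ in $V_{(-1,1)}$, $V_{(1,1)}$, $V_{(1,-1)}$, $V_{(-1,-1)}$, $V_{(0,-1)}$, $V_{(-1,0)}$, $V_{(1,0)}$, $V_{(0,1)}$, $V_{(0,0)}$ respectively. Let $U=L=H$ on $\mathcal S\setminus\mathcal N$, and $U=-L=\max(|J^1|,|J^2|)$ on $\mathcal N$. Let $R_1:=\mu^{-1}(0)\cap(V_{(-1,1)}\cup V_{(1,-1)})$ and $R_2:=\mu^{-1}(0)\cap(V_{(1,1)}\cup V_{(-1,-1)})$. For $q\in\mathbb R$ let $$\mathcal L=\{\mu<0\},\quad \mathcal U=\{\mu>0\},\quad \hat{\mathcal L}=\{s:\tau_n^{-1}(\hat\gamma^1_n\Delta\hat\gamma^2_n)(s)<-q\},\quad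 \hat{\mathcal U}=\{s:\tau_n^{-1}(\hat\gamma^1_n\Delta\hat\gamma^2_n)(s)>q\}.$$ Suprema over the empty set are $-\infty$. Write $$M:=\max\Big(\max_{i\in\{1,2\}}\sup_{s\in R_i}|J^i(s)|,\ \sup_{s\in V_{(0,0)}}|(J^1\Delta J^2)(s)|\Big).$$ **Corollary.** Suppose that one of the following holds: * **S1:** for every $\kappa\in\mathcal I$, $\overline{\mu^{-1}(0)\cap V_\kappa}=\mu^{-1}(0)\cap\overline{V_\kappa}$; * $\widetilde{\textbf{S1}}$**:** for every $\kappa\in\mathcal I$ and $s\in\mu^{-1}(0)\cap\overline{V_\kappa}$, for all sufficiently small $\delta>0$ the sets $B_\delta(s)\cap\mu^{-1}([0,\infty))\cap V_\kappa$ and $B_\delta(s)\cap\mu^{-1}((-\infty,0])\cap V_\kappa$ are non-empty and $B_\delta(s)\cap V_\kappa$ is path-connected. Suppose in addition that * **S2:** almost surely $\sup_{\mu^{-1}(0)}(-L)=\sup_{\mu^{-1}(0)}(-H)$, and almost surely $\sup_{\mu^{-1}(0)}U=\sup_{\mu^{-1}(0)}H$; * **S3:** $\mathbb P[M=q]=0$.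 Then $$\lim_{n\to\infty}\mathbb P\big[\hat{\mathcal L}\subseteq\mathcal L\ \wedge\ \hat{\mathcal U}\subseteq\mathcal U\big]=\mathbb P[M\le q],$$ where, as the inclusion event need not be measurable, the claim is that both its inner probability $\mathbb P_*$ and its outer probability $\mathbb P^*$ converge to $\mathbb P[M\le q]$. -/

import Mathlib

open scoped ENNReal Topology
open Filter MeasureTheory

noncomputable section

namespace SymDiffCR

/-! ### Inner and outer probability, outer expectation, weak convergence -/

section Probability

variable {Ω : Type*} [MeasurableSpace Ω]

/-- Outer probability of an arbitrary (possibly non-measurable) set. -/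
def outerProb (P : Measure Ω) (B : Set Ω) : ℝ≥0∞ :=
  ⨅ (A : Set Ω) (_ : B ⊆ A) (_ : MeasurableSet A), P A

/-- Inner probability of an arbitrary (possibly non-measurable) set. -/
def innerProb (P : Measure Ω) (B : Set Ω) : ℝ≥0∞ :=
  1 - outerProb P Bᶜ

/-- Mathlib evaluates a measure at a non-measurable set through its outer measure. -/
theorem outerProb_eq (P : Measure Ω) (B : Set Ω) : outerProb P B = P B :=
  (measure_eq_iInf B).symm

/-- Outer expectation of an arbitrary bounded function `T`: the infimum of `E[U]` over the measurable
integrable majorants `U` of `T`. -/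
def outerExpectation (P : Measure Ω) (T : Ω → ℝ) : ℝ :=
  sInf {e : ℝ | ∃ U : Ω → ℝ, Measurable U ∧ Integrable U P ∧ (∀ ω, T ω ≤ U ω) ∧ e = ∫ ω, U ω ∂P}

/-- Weak convergence (in the sense of Hoffmann-Jørgensen) of arbitrary maps `X n : Ω → D` to a
Borel measurable map `Y : Ω → D`: `E^*[f (X n)] → E[f Y]` for every bounded continuous `f`. -/
def ConvergesWeakly {D : Type*} [TopologicalSpace D] (P : Measure Ω)
    (X : ℕ → Ω → D) (Y : Ω → D) : Prop :=
  @Measurable Ω D _ (borel D) Y ∧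
    ∀ f : BoundedContinuousFunction D ℝ,
      Tendsto (fun n => outerExpectation P (fun ω => f (X n ω))) atTop (𝓝 (∫ ω, f (Y ω) ∂P))

end Probability

/-! ### Function spaces -/

/-- The space of bounded real functions on `S`, with the supremum norm. -/
abbrev LInf (S : Type*) : Type _ := lp (fun _ : S => ℝ) ∞

/-- The inclusion of `C(S, ℝ)` in the bounded functions, for `S` compact. -/
def toLInf {S : Type*} [TopologicalSpace S] [CompactSpace S] (f : C(S, ℝ)) : LInf S :=
  ⟨fun s => f s, memℓp_infty ⟨‖f‖, by rintro _ ⟨s, rfl⟩; exact f.norm_coe_le_norm s⟩⟩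

/-- Supremum over a set, with values in the extended reals; it is `-∞` over the empty set. -/
def supOn {S : Type*} (A : Set S) (f : S → ℝ) : EReal := ⨆ s ∈ A, (f s : EReal)

/-! ### The symmetric difference

The indices `1, 2` of the two signals are `0, 1 : Fin 2`; the signs `-1, 0, 1` are the elements of `SignType`. -/

/-- The symmetric difference of two real numbers. -/
def sdiff (a b : ℝ) : ℝ := max (min (-a) b) (min a (-b))

section Signal

variable {S : Type*} [TopologicalSpace S]

/-- The target function `γ¹ Δ γ²`. -/
def target (γ : Fin 2 → C(S, ℝ)) (s : S) : ℝ := sdiff (γ 0 s) (γ 1 s)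

/-- The level set of the target function at `0`. -/
def zeroSet (γ : Fin 2 → C(S, ℝ)) : Set S := {s | target γ s = 0}

/-- The signs of `γ¹ - γ²` and `γ¹ + γ²` at `s`. -/
def signs (γ : Fin 2 → C(S, ℝ)) (s : S) : SignType × SignType :=
  (SignType.sign (γ 0 s - γ 1 s), SignType.sign (γ 0 s + γ 1 s))

/-- The partition of `S` by the signs of `γ¹ - γ²` and `γ¹ + γ²`. -/
def V (γ : Fin 2 → C(S, ℝ)) (κ : SignType × SignType) : Set S := {s | signs γ s = κ}

/-- The union of `V (0, 0) ∩ closure (V κ)` over `κ ∈ {-1, 1}²`. -/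
def N (γ : Fin 2 → C(S, ℝ)) : Set S :=
  ⋃ κ ∈ {κ : SignType × SignType | κ.1 ≠ 0 ∧ κ.2 ≠ 0}, V γ (0, 0) ∩ closure (V γ κ)

/-- The value of the limit process at a location with sign pair `κ`, where the two limiting
processes of the signals have the values `a` and `b`. -/
def limitValue (κ : SignType × SignType) (a b : ℝ) : ℝ :=
  match κ with
  | (SignType.neg, SignType.pos) => -a
  | (SignType.pos, SignType.pos) => -b
  | (SignType.pos, SignType.neg) => a
  | (SignType.neg, SignType.neg) => b
  | (SignType.zero, SignType.neg) => max a b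
  | (SignType.neg, SignType.zero) => min (-a) b
  | (SignType.pos, SignType.zero) => min a (-b)
  | (SignType.zero, SignType.pos) => max (-a) (-b)
  | (SignType.zero, SignType.zero) => sdiff a b

/-- A path of the pointwise limit `H`, given a path `j` of the limit of the signal errors. -/
def H (γ j : Fin 2 → C(S, ℝ)) (s : S) : ℝ := limitValue (signs γ s) (j 0 s) (j 1 s)

open Classical in
/-- A path of the upper confinement limit `U`. -/
def U (γ j : Fin 2 → C(S, ℝ)) (s : S) : ℝ :=
  if s ∈ N γ then max |j 0 s| |j 1 s| else H γ j s

open Classical in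
/-- A path of the lower confinement limit `L`. -/
def L (γ j : Fin 2 → C(S, ℝ)) (s : S) : ℝ :=
  if s ∈ N γ then -max |j 0 s| |j 1 s| else H γ j s

/-- The sets `R₁` and `R₂`. -/
def R (γ : Fin 2 → C(S, ℝ)) (i : Fin 2) : Set S :=
  zeroSet γ ∩ (if i = 0 then V γ (-1, 1) ∪ V γ (1, -1) else V γ (1, 1) ∪ V γ (-1, -1))

/-- The limit statistic
`max (max_i sup_{R_i} |J^i|, sup_{V_(0,0)} |J¹ Δ J²|)`, for a path `j` of `(J¹, J²)`. -/
def limitStat (γ j : Fin 2 → C(S, ℝ)) : EReal :=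
  max (max (supOn (R γ 0) fun s => |j 0 s|) (supOn (R γ 1) fun s => |j 1 s|))
    (supOn (V γ (0, 0)) fun s => |sdiff (j 0 s) (j 1 s)|)

/-- Condition S1. -/
def CondS1 (γ : Fin 2 → C(S, ℝ)) : Prop :=
  ∀ κ : SignType × SignType, closure (zeroSet γ ∩ V γ κ) = zeroSet γ ∩ closure (V γ κ)

end Signal

/-- The ball condition, the alternative to S1. -/
def CondBall {S : Type*} [MetricSpace S] (γ : Fin 2 → C(S, ℝ)) : Prop :=
  ∀ κ : SignType × SignType, ∀ s ∈ zeroSet γ, s ∈ closure (V γ κ) →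
    ∃ δ₀ > 0, ∀ δ, 0 < δ → δ < δ₀ →
      (Metric.ball s δ ∩ {t | 0 ≤ target γ t} ∩ V γ κ).Nonempty ∧
      (Metric.ball s δ ∩ {t | target γ t ≤ 0} ∩ V γ κ).Nonempty ∧
      IsPathConnected (Metric.ball s δ ∩ V γ κ)

section Estimation

variable {S : Type*}

/-- The lower excursion set of the target. -/
def lowerSet [TopologicalSpace S] (γ : Fin 2 → C(S, ℝ)) : Set S := {s | target γ s < 0}

/-- The upper excursion set of the target. -/
def upperSet [TopologicalSpace S] (γ : Fin 2 → C(S, ℝ)) : Set S := {s | 0 < target γ s}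

/-- The lower confidence region built from the estimates `g` with rate `t` and quantile `q`. -/
def lowerCR (t q : ℝ) (g : Fin 2 → LInf S) : Set S := {s | t⁻¹ * sdiff (g 0 s) (g 1 s) < -q}

/-- The upper confidence region built from the estimates `g` with rate `t` and quantile `q`. -/
def upperCR (t q : ℝ) (g : Fin 2 → LInf S) : Set S := {s | q < t⁻¹ * sdiff (g 0 s) (g 1 s)}

/-- The normalised errors `τ⁻¹ (g^i - γ^i)` of the estimates. -/
def normalisedError [TopologicalSpace S] [CompactSpace S] (γ : Fin 2 → C(S, ℝ)) (t : ℝ)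
    (g : Fin 2 → LInf S) : Fin 2 → LInf S :=
  fun i => t⁻¹ • (g i - toLInf (γ i))

/-- The event that both confidence regions are contained in their targets. -/
def inclusionEvent [TopologicalSpace S] {Ω : Type*} (γ : Fin 2 → C(S, ℝ)) (t q : ℝ)
    (g : Ω → Fin 2 → LInf S) : Set Ω :=
  {ω | lowerCR t q (g ω) ⊆ lowerSet γ ∧ upperCR t q (g ω) ⊆ upperSet γ}

end Estimation

end SymDiffCR

end

open SymDiffCR

open SymDiffCR

namespace SymDiffCR

/-! ### The symmetric difference of two numbers -/

/-! Multiplying by a positive scale commutes with `sdiff`, so the inclusion event says that the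
normalised errors lie in a deterministic set `inclusionErrors γ q (τ n)`. A portmanteau bound for
varying sets (`ConvergesWeakly.eventually_lt`) controls outer probabilities of such events by the
probability that the limit is a limit point of the sets. Applied to the sets it bounds the outer
probability from above; applied to their complements it bounds the inner probability from below.

What remains is deterministic, for a fixed continuous path `j`. On the zero set of the target,
normalised estimates converge pointwise to `H`, and `limitStat` is the supremum of `|H|` there;
hence `j` can be a limit point of the sets only if `limitStat γ j ≤ q`
(`limitStat_le_of_frequently`). Conversely, if `limitStat γ j < q`, all errors near `j` at small
scales give the inclusions (`eventually_mem_inclusionErrors`). This needs local uniformity in the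
location, which can fail only on `N`, where just the crude bound `max |j 0| |j 1|` is available; S2
keeps that bound below `q`. Compactness makes the local statements global, and S3 removes the
boundary case `limitStat = q`. -/

theorem sdiff_zero_left (b : ℝ) : sdiff 0 b = 0 := by
  unfold sdiff; rcases le_total 0 b with h | h <;> simp [h]

theorem sdiff_zero_right (a : ℝ) : sdiff a 0 = 0 := by
  unfold sdiff; rcases le_total 0 a with h | h <;> simp [h]

theorem sdiff_eq_neg_left {a b : ℝ} (h : |a| ≤ b) : sdiff a b = -a := by
  have h' := abs_le.1 h
  unfold sdiff
  rw [min_eq_left (by linarith), min_eq_right (by linarith), max_eq_left (by linarith)]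

theorem sdiff_eq_left {a b : ℝ} (h : |a| ≤ -b) : sdiff a b = a := by
  have h' := abs_le.1 h
  unfold sdiff
  rw [min_eq_right (by linarith), min_eq_left (by linarith), max_eq_right (by linarith)]

theorem sdiff_comm (a b : ℝ) : sdiff a b = sdiff b a := by
  unfold sdiff; rw [max_comm, min_comm, min_comm (-a)]

theorem sdiff_eq_neg_right {a b : ℝ} (h : |b| ≤ a) : sdiff a b = -b := by
  rw [sdiff_comm, sdiff_eq_neg_left h]

theorem sdiff_eq_right {a b : ℝ} (h : |b| ≤ -a) : sdiff a b = b := by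
  rw [sdiff_comm, sdiff_eq_left h]

theorem sdiff_self (a : ℝ) : sdiff a a = -|a| := by
  rcases le_total 0 a with h | h
  · rw [sdiff_eq_neg_left (abs_of_nonneg h).le, abs_of_nonneg h]
  · rw [sdiff_eq_left (abs_of_nonpos h).le, abs_of_nonpos h, neg_neg]

theorem sdiff_neg_self (a : ℝ) : sdiff a (-a) = |a| := by
  rcases le_total 0 a with h | h
  · rw [sdiff_eq_left (by rw [abs_of_nonneg h, neg_neg]), abs_of_nonneg h]
  · rw [sdiff_eq_neg_left (abs_of_nonpos h).le, abs_of_nonpos h]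

theorem sdiff_eq_zero_iff {a b : ℝ} : sdiff a b = 0 ↔ a = 0 ∨ b = 0 := by
  refine ⟨fun h => ?_, ?_⟩
  · rcases le_total |a| |b| with hab | hab
    · left
      rcases abs_cases b with ⟨hb, -⟩ | ⟨hb, -⟩ <;> rw [hb] at hab
      · simpa [sdiff_eq_neg_left hab] using h
      · simpa [sdiff_eq_left hab] using h
    · right
      rcases abs_cases a with ⟨hb, -⟩ | ⟨hb, -⟩ <;> rw [hb] at hab
      · simpa [sdiff_eq_neg_right hab] using h
      · simpa [sdiff_eq_right hab] using h
  · rintro (rfl | rfl)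
    · exact sdiff_zero_left b
    · exact sdiff_zero_right a

theorem mul_sdiff {c : ℝ} (hc : 0 ≤ c) (a b : ℝ) : c * sdiff a b = sdiff (c * a) (c * b) := by
  unfold sdiff
  rw [mul_max_of_nonneg _ _ hc, mul_min_of_nonneg _ _ hc, mul_min_of_nonneg _ _ hc,
    mul_neg, mul_neg]

theorem continuous_sdiff : Continuous fun p : ℝ × ℝ => sdiff p.1 p.2 := by
  unfold sdiff; fun_prop

/-- Minima and maxima are nonexpansive. The estimate serves where no single linear branch of `sdiff`
can be fixed. -/
theorem abs_sdiff_sub_sdiff_le (a b a' b' : ℝ) :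
    |sdiff a b - sdiff a' b'| ≤ max |a - a'| |b - b'| := by
  unfold sdiff
  refine (abs_max_sub_max_le_max _ _ _ _).trans (max_le ?_ ?_)
  · refine (abs_min_sub_min_le_max _ _ _ _).trans (le_of_eq ?_)
    rw [neg_sub_neg, abs_sub_comm a']
  · refine (abs_min_sub_min_le_max _ _ _ _).trans (le_of_eq ?_)
    rw [neg_sub_neg, abs_sub_comm b']

/-! ### The zero set of the target and the limit statistic -/

theorem supOn_le_iff {S : Type*} {A : Set S} {f : S → ℝ} {c : EReal} :
    supOn A f ≤ c ↔ ∀ s ∈ A, (f s : EReal) ≤ c := iSup₂_le_iff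

section Zero

variable {S : Type*} [TopologicalSpace S] {γ : Fin 2 → C(S, ℝ)} {s : S}

theorem mem_zeroSet : s ∈ zeroSet γ ↔ γ 0 s = 0 ∨ γ 1 s = 0 := sdiff_eq_zero_iff

theorem mem_V_zero : s ∈ V γ (0, 0) ↔ γ 0 s = 0 ∧ γ 1 s = 0 := by
  simp only [V, signs, Set.mem_ofPred_eq, Prod.mk.injEq, sign_eq_zero_iff]
  constructor <;> rintro ⟨h1, h2⟩ <;> constructor <;> linarith

theorem signs_of_left_zero_of_pos (h0 : γ 0 s = 0) (h1 : 0 < γ 1 s) : signs γ s = (-1, 1) := by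
  simp [signs, h0, h1]

theorem signs_of_left_zero_of_neg (h0 : γ 0 s = 0) (h1 : γ 1 s < 0) : signs γ s = (1, -1) := by
  simp [signs, h0, h1]

theorem signs_of_right_zero_of_pos (h1 : γ 1 s = 0) (h0 : 0 < γ 0 s) : signs γ s = (1, 1) := by
  simp [signs, h0, h1]

theorem signs_of_right_zero_of_neg (h1 : γ 1 s = 0) (h0 : γ 0 s < 0) :
    signs γ s = (-1, -1) := by
  simp [signs, h0, h1]

theorem signs_of_zero (h0 : γ 0 s = 0) (h1 : γ 1 s = 0) : signs γ s = (0, 0) := by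
  simp [signs, h0, h1]

theorem mem_R_zero : s ∈ R γ 0 ↔ γ 0 s = 0 ∧ γ 1 s ≠ 0 := by
  simp only [R, if_true, Set.mem_inter_iff, Set.mem_union, mem_zeroSet]
  constructor
  · rintro ⟨h | h, h' | h'⟩ <;>
      simp only [V, signs, h, Set.mem_ofPred_eq, Prod.mk.injEq, sign_eq_one_iff,
        sign_eq_neg_one_iff] at h' <;> obtain ⟨h1, h2⟩ := h'
    · exact ⟨h, by intro; linarith⟩
    · exact ⟨h, by intro; linarith⟩
    · linarith
    · linarith
  · rintro ⟨h0, h1⟩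
    refine ⟨Or.inl h0, ?_⟩
    rcases lt_or_gt_of_ne h1 with h | h
    · exact Or.inr (signs_of_left_zero_of_neg h0 h)
    · exact Or.inl (signs_of_left_zero_of_pos h0 h)

theorem mem_R_one : s ∈ R γ 1 ↔ γ 1 s = 0 ∧ γ 0 s ≠ 0 := by
  simp only [R, if_neg one_ne_zero, Set.mem_inter_iff, Set.mem_union, mem_zeroSet]
  constructor
  · rintro ⟨h | h, h' | h'⟩ <;>
      simp only [V, signs, h, Set.mem_ofPred_eq, Prod.mk.injEq, sign_eq_one_iff,
        sign_eq_neg_one_iff] at h' <;> obtain ⟨h1, h2⟩ := h'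
    · linarith
    · linarith
    · exact ⟨h, by intro; linarith⟩
    · exact ⟨h, by intro; linarith⟩
  · rintro ⟨h1, h0⟩
    refine ⟨Or.inr h1, ?_⟩
    rcases lt_or_gt_of_ne h0 with h | h
    · exact Or.inr (signs_of_right_zero_of_neg h1 h)
    · exact Or.inl (signs_of_right_zero_of_pos h1 h)

theorem abs_H_of_left_zero (j : Fin 2 → C(S, ℝ)) (h0 : γ 0 s = 0) (h1 : γ 1 s ≠ 0) :
    |H γ j s| = |j 0 s| := by
  rcases lt_or_gt_of_ne h1 with h | h
  · rw [H, signs_of_left_zero_of_neg h0 h]; rfl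
  · rw [H, signs_of_left_zero_of_pos h0 h]; exact abs_neg _

theorem abs_H_of_right_zero (j : Fin 2 → C(S, ℝ)) (h1 : γ 1 s = 0) (h0 : γ 0 s ≠ 0) :
    |H γ j s| = |j 1 s| := by
  rcases lt_or_gt_of_ne h0 with h | h
  · rw [H, signs_of_right_zero_of_neg h1 h]; rfl
  · rw [H, signs_of_right_zero_of_pos h1 h]; exact abs_neg _

theorem H_of_zero (j : Fin 2 → C(S, ℝ)) (h0 : γ 0 s = 0) (h1 : γ 1 s = 0) :
    H γ j s = sdiff (j 0 s) (j 1 s) := by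
  rw [H, signs_of_zero h0 h1]; rfl

/-- The limit statistic is the supremum of `|H|` over the zero set of the target. -/
theorem limitStat_eq (γ j : Fin 2 → C(S, ℝ)) :
    limitStat γ j = supOn (zeroSet γ) fun s => |H γ j s| := by
  refine eq_of_forall_ge_iff fun c => ?_
  simp only [limitStat, max_le_iff, supOn_le_iff, mem_R_zero, mem_R_one, mem_V_zero, mem_zeroSet]
  constructor
  · rintro ⟨⟨h0, h1⟩, h2⟩ s hs
    by_cases g0 : γ 0 s = 0
    · by_cases g1 : γ 1 s = 0
      · rw [H_of_zero j g0 g1]; exact h2 s ⟨g0, g1⟩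
      · rw [abs_H_of_left_zero j g0 g1]; exact h0 s ⟨g0, g1⟩
    · have g1 := hs.resolve_left g0
      rw [abs_H_of_right_zero j g1 g0]; exact h1 s ⟨g1, g0⟩
  · intro h
    refine ⟨⟨fun s hs => ?_, fun s hs => ?_⟩, fun s hs => ?_⟩
    · rw [← abs_H_of_left_zero j hs.1 hs.2]; exact h s (Or.inl hs.1)
    · rw [← abs_H_of_right_zero j hs.1 hs.2]; exact h s (Or.inr hs.1)
    · rw [← H_of_zero j hs.1 hs.2]; exact h s (Or.inl hs.1)

theorem target_eq_of_fst_zero (h : (signs γ s).1 = 0) : target γ s = -|γ 0 s| := by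
  have : γ 1 s = γ 0 s := by
    have := sign_eq_zero_iff.1 h
    linarith
  rw [target, this, sdiff_self]

theorem target_eq_of_snd_zero (h : (signs γ s).2 = 0) : target γ s = |γ 0 s| := by
  have : γ 1 s = -γ 0 s := by
    have := sign_eq_zero_iff.1 h
    linarith
  rw [target, this, sdiff_neg_self]

/-- On `γ¹ = ±γ²` the target is `∓|γ¹|`, so its vanishing forces both signals to vanish. -/
theorem signs_eq_zero_of_mem_zeroSet (hs : s ∈ zeroSet γ)
    (h : (signs γ s).1 = 0 ∨ (signs γ s).2 = 0) : signs γ s = (0, 0) := by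
  have key : γ 0 s = 0 := by
    have hs' : target γ s = 0 := hs
    rcases h with h | h
    · simpa [target_eq_of_fst_zero h] using hs'
    · simpa [target_eq_of_snd_zero h] using hs'
  refine signs_of_zero key ?_
  rcases h with h | h <;> have := sign_eq_zero_iff.1 h <;> linarith

end Zero

/-- Such a `V γ κ` misses the zero set. Under S1 the closure in question is then that of the empty
set. Under the ball condition, `V γ κ` would contain points with target of either weak sign, whereas
the target is strictly of one sign on it. -/
theorem notMem_closure_V {S : Type*} [MetricSpace S] {γ : Fin 2 → C(S, ℝ)}
    (h : CondS1 γ ∨ CondBall γ) {κ : SignType × SignType} (hκ : κ.1 = 0 ∨ κ.2 = 0)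
    (hκ0 : κ ≠ (0, 0)) {s : S} (hs : s ∈ zeroSet γ) : s ∉ closure (V γ κ) := by
  intro hsV
  have hdisj : ∀ t ∈ zeroSet γ, t ∉ V γ κ := by
    rintro t ht rfl
    exact hκ0 (signs_eq_zero_of_mem_zeroSet ht hκ)
  rcases h with h | h
  · have h1 : zeroSet γ ∩ V γ κ = ∅ := by
      ext t; simpa using hdisj t
    have : s ∈ closure (zeroSet γ ∩ V γ κ) := by rw [h κ]; exact ⟨hs, hsV⟩
    simp [h1] at this
  · obtain ⟨δ, hδ, hδ'⟩ := h κ s hs hsV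
    obtain ⟨⟨t, ⟨-, ht⟩, htV⟩, ⟨u, ⟨-, hu⟩, huV⟩, -⟩ := hδ' (δ / 2) (by linarith) (by linarith)
    rcases hκ with hκ | hκ
    · refine hdisj t (le_antisymm ?_ ht) htV
      rw [target_eq_of_fst_zero (by rw [show signs γ t = κ from htV, hκ])]
      simp
    · refine hdisj u (le_antisymm hu ?_) huV
      rw [target_eq_of_snd_zero (by rw [show signs γ u = κ from huV, hκ])]
      simp

/-- Off `N`, the points of `V (0, 0)` are interior. -/
theorem eventually_mem_V_zero {S : Type*} [MetricSpace S] {γ : Fin 2 → C(S, ℝ)}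
    (h : CondS1 γ ∨ CondBall γ) {s : S} (hs : s ∈ V γ (0, 0)) (hN : s ∉ N γ) :
    ∀ᶠ t in 𝓝 s, t ∈ V γ (0, 0) := by
  have hZ : s ∈ zeroSet γ := mem_zeroSet.2 (Or.inl (mem_V_zero.1 hs).1)
  have key : ∀ κ : SignType × SignType, κ ≠ (0, 0) → ∀ᶠ t in 𝓝 s, t ∉ V γ κ := by
    intro κ hκ0
    have : s ∉ closure (V γ κ) := by
      by_cases hκ : κ.1 = 0 ∨ κ.2 = 0
      · exact notMem_closure_V h hκ hκ0 hZ
      · intro hcl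
        refine hN (Set.mem_iUnion₂.2 ⟨κ, ?_, hs, hcl⟩)
        simpa [not_or] using hκ
    filter_upwards [isClosed_closure.isOpen_compl.mem_nhds this] with t ht htV
    exact ht (subset_closure htV)
  have hall : ∀ᶠ t in 𝓝 s, ∀ κ : SignType × SignType, κ ≠ (0, 0) → t ∉ V γ κ := by
    -- There are only finitely many sign pairs.
    rw [Filter.eventually_all]
    intro κ
    by_cases hκ : κ = (0, 0)
    · simp [hκ]
    · simpa [hκ] using key κ hκ
  filter_upwards [hall] with t ht
  by_contra hc
  exact ht (signs γ t) hc rfl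

/-! ### Convergence along converging errors -/

section Local

variable {S : Type*} [MetricSpace S]

/-- The normalised estimate `t⁻¹ ((γ¹ + t x¹) Δ (γ² + t x²))` for the normalised errors `x`. -/
noncomputable def normalisedEstimate (γ : Fin 2 → C(S, ℝ)) (t : ℝ) (x : Fin 2 → LInf S) (s : S) : ℝ :=
  sdiff (t⁻¹ * γ 0 s + x 0 s) (t⁻¹ * γ 1 s + x 1 s)

/-- The normalised errors for which both confidence regions are contained in their targets. -/
def inclusionErrors (γ : Fin 2 → C(S, ℝ)) (q t : ℝ) : Set (Fin 2 → LInf S) :=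
  {x | ∀ s, (0 ≤ target γ s → -q ≤ normalisedEstimate γ t x s) ∧
    (target γ s ≤ 0 → normalisedEstimate γ t x s ≤ q)}

theorem abs_normalisedEstimate_sub_le {γ : Fin 2 → C(S, ℝ)} {t : ℝ} (ht : 0 < t)
    (x : Fin 2 → LInf S) (s : S) :
    |normalisedEstimate γ t x s - t⁻¹ * target γ s| ≤ max |x 0 s| |x 1 s| := by
  rw [target, mul_sdiff (inv_pos.2 ht).le, normalisedEstimate]
  refine (abs_sdiff_sub_sdiff_le _ _ _ _).trans (le_of_eq ?_)
  simp

/-- Where `g s > 0`, the scaled values `t⁻¹ g` dominate every convergent quantity. -/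
theorem eventually_lt_inv_mul {F : Filter (Fin 2 → LInf S)} {g : S → ℝ} {s : S}
    (hg : ContinuousAt g s) (hpos : 0 < g s) {f : S × (ℝ × (Fin 2 → LInf S)) → ℝ} {c : ℝ}
    (hf : Tendsto f (𝓝 s ×ˢ (𝓝[>] 0 ×ˢ F)) (𝓝 c)) :
    ∀ᶠ z in 𝓝 s ×ˢ (𝓝[>] 0 ×ˢ F), f z < z.2.1⁻¹ * g z.1 := by
  have h1 : Tendsto (fun z : S × (ℝ × (Fin 2 → LInf S)) => z.2.1⁻¹ * g z.1)
      (𝓝 s ×ˢ (𝓝[>] 0 ×ˢ F)) atTop :=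
    Tendsto.atTop_mul_pos hpos
      (tendsto_inv_nhdsGT_zero.comp (tendsto_fst.comp tendsto_snd))
      (Tendsto.comp hg tendsto_fst)
  filter_upwards [h1.eventually_gt_atTop (c + 1), hf.eventually_lt_const (lt_add_one c)]
    with z h2 h3
  exact h3.trans h2

theorem eventually_pos_scale (s : S) (F : Filter (Fin 2 → LInf S)) :
    ∀ᶠ z : S × (ℝ × (Fin 2 → LInf S)) in 𝓝 s ×ˢ (𝓝[>] 0 ×ˢ F), 0 < z.2.1 :=
  (tendsto_fst.comp tendsto_snd).eventually
    (self_mem_nhdsWithin : Set.Ioi (0 : ℝ) ∈ 𝓝[>] (0 : ℝ))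

variable [CompactSpace S]

/-- The randomness now enters only through the normalised errors; each inclusion is read as its
contrapositive. -/
theorem inclusionEvent_eq {Ω : Type*} (γ : Fin 2 → C(S, ℝ)) {t : ℝ} (ht : 0 < t) (q : ℝ)
    (g : Ω → Fin 2 → LInf S) :
    inclusionEvent γ t q g = {ω | normalisedError γ t (g ω) ∈ inclusionErrors γ q t} := by
  have key : ∀ ω s, t⁻¹ * sdiff (g ω 0 s) (g ω 1 s)
      = normalisedEstimate γ t (normalisedError γ t (g ω)) s := by
    intro ω s
    have h : ∀ i, (normalisedError γ t (g ω) i : S → ℝ) s = t⁻¹ * (g ω i s - γ i s) :=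
      fun i => rfl
    rw [mul_sdiff (inv_pos.2 ht).le, normalisedEstimate, h, h]
    congr 1 <;> ring
  ext ω
  simp only [inclusionEvent, inclusionErrors, lowerCR, upperCR, lowerSet, upperSet, key,
    Set.mem_ofPred_eq, Set.ofPred_subset_ofPred]
  rw [← forall_and]
  refine forall_congr' fun s => ?_
  constructor
  · rintro ⟨h1, h2⟩
    exact ⟨fun h => not_lt.1 fun h' => (h1 h').not_ge h,
      fun h => not_lt.1 fun h' => (h2 h').not_ge h⟩
  · rintro ⟨h1, h2⟩
    exact ⟨fun h => not_le.1 fun h' => (h1 h').not_gt h,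
      fun h => not_le.1 fun h' => (h2 h').not_gt h⟩

/-- Uniform convergence to a continuous limit permits the evaluation point to move together with the
error. -/
theorem tendsto_eval_toLInf (j : Fin 2 → C(S, ℝ)) (i : Fin 2) (s : S) :
    Tendsto (fun z : S × (ℝ × (Fin 2 → LInf S)) => z.2.2 i z.1)
      (𝓝 s ×ˢ (𝓝[>] 0 ×ˢ 𝓝 fun i => toLInf (j i))) (𝓝 (j i s)) := by
  have h1 : Tendsto (fun z : S × (ℝ × (Fin 2 → LInf S)) => j i z.1)
      (𝓝 s ×ˢ (𝓝[>] 0 ×ˢ 𝓝 fun i => toLInf (j i))) (𝓝 (j i s)) :=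
    ((j i).continuous.tendsto s).comp tendsto_fst
  have h2 : Tendsto (fun z : S × (ℝ × (Fin 2 → LInf S)) => z.2.2 i - toLInf (j i))
      (𝓝 s ×ˢ (𝓝[>] 0 ×ˢ 𝓝 fun i => toLInf (j i))) (𝓝 0) := by
    have h3 : Tendsto (fun z : S × (ℝ × (Fin 2 → LInf S)) => z.2.2 i)
        (𝓝 s ×ˢ (𝓝[>] 0 ×ˢ 𝓝 fun i => toLInf (j i))) (𝓝 (toLInf (j i))) :=
      ((continuous_apply i).tendsto (fun i => toLInf (j i))).comp (tendsto_snd.comp tendsto_snd)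
    simpa using h3.sub_const (toLInf (j i))
  have h4 : Tendsto (fun z : S × (ℝ × (Fin 2 → LInf S)) => (z.2.2 i - toLInf (j i)) z.1)
      (𝓝 s ×ˢ (𝓝[>] 0 ×ˢ 𝓝 fun i => toLInf (j i))) (𝓝 0) :=
    squeeze_zero_norm (fun z => lp.norm_apply_le_norm ENNReal.top_ne_zero _ z.1)
      (by simpa using h2.norm)
  have h5 := h4.add h1
  rw [zero_add] at h5
  refine h5.congr fun z => ?_
  have : (z.2.2 i - toLInf (j i)) z.1 = z.2.2 i z.1 - j i z.1 := rfl
  rw [this, sub_add_cancel]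

/-- Where exactly one signal vanishes, the estimate is driven by the error of that signal. -/
theorem tendsto_normalisedEstimate_sub (γ j : Fin 2 → C(S, ℝ)) {s : S} (hs : s ∈ zeroSet γ)
    (h0 : s ∉ V γ (0, 0)) :
    Tendsto (fun z : S × (ℝ × (Fin 2 → LInf S)) =>
      normalisedEstimate γ z.2.1 z.2.2 z.1 - z.2.1⁻¹ * target γ z.1)
      (𝓝 s ×ˢ (𝓝[>] 0 ×ˢ 𝓝 fun i => toLInf (j i))) (𝓝 (H γ j s)) := by
  have e0 := tendsto_eval_toLInf j 0 s
  have e1 := tendsto_eval_toLInf j 1 s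
  have c0 : ContinuousAt (γ 0) s := (γ 0).continuous.continuousAt
  have c1 : ContinuousAt (γ 1) s := (γ 1).continuous.continuousAt
  have hP := eventually_pos_scale s (𝓝 fun i => toLInf (j i))
  rw [mem_V_zero] at h0
  rcases mem_zeroSet.1 hs with h | h
  · rcases lt_trichotomy (γ 1 s) 0 with h' | h' | h'
    · rw [H, signs_of_left_zero_of_neg h h']
      refine e0.congr' ?_
      -- The two scaled inequalities put the perturbed pair, and the last condition the unperturbed
      -- pair, on the linear branch where `sdiff` returns its first argument; the difference is then
      -- exactly the error of the first signal. The other three cases differ only in the branch.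
      filter_upwards [hP,
        eventually_lt_inv_mul (g := fun s => -γ 1 s - γ 0 s) (by fun_prop) (by linarith)
          (e0.add e1),
        eventually_lt_inv_mul (g := fun s => -γ 1 s + γ 0 s) (by fun_prop) (by linarith)
          (e1.sub e0),
        (tendsto_fst (g := (𝓝[>] 0 ×ˢ 𝓝 fun i => toLInf (j i)))).eventually
          ((by fun_prop : ContinuousAt (fun s => -γ 1 s - |γ 0 s|) s).eventually
            (lt_mem_nhds (by simp [h, h'] : (0 : ℝ) < -γ 1 s - |γ 0 s|)))] with z hz h2 h3 h4
      rw [normalisedEstimate, target, sdiff_eq_left (a := γ 0 z.1) (by linarith), sdiff_eq_left]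
      · ring
      · rw [abs_le]; constructor <;> linarith
    · exact absurd ⟨h, h'⟩ h0
    · rw [H, signs_of_left_zero_of_pos h h']
      refine e0.neg.congr' ?_
      filter_upwards [hP,
        eventually_lt_inv_mul (g := fun s => γ 1 s - γ 0 s) (by fun_prop) (by linarith)
          (e0.sub e1),
        eventually_lt_inv_mul (g := fun s => γ 1 s + γ 0 s) (by fun_prop) (by linarith)
          (e1.add e0).neg,
        (tendsto_fst (g := (𝓝[>] 0 ×ˢ 𝓝 fun i => toLInf (j i)))).eventually
          ((by fun_prop : ContinuousAt (fun s => γ 1 s - |γ 0 s|) s).eventually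
            (lt_mem_nhds (by simp [h, h'] : (0 : ℝ) < γ 1 s - |γ 0 s|)))] with z hz h2 h3 h4
      rw [normalisedEstimate, target, sdiff_eq_neg_left (a := γ 0 z.1) (by linarith),
        sdiff_eq_neg_left]
      · ring
      · rw [abs_le]; constructor <;> linarith
  · rcases lt_trichotomy (γ 0 s) 0 with h' | h' | h'
    · rw [H, signs_of_right_zero_of_neg h h']
      refine e1.congr' ?_
      filter_upwards [hP,
        eventually_lt_inv_mul (g := fun s => -γ 0 s - γ 1 s) (by fun_prop) (by linarith)
          (e0.add e1),
        eventually_lt_inv_mul (g := fun s => -γ 0 s + γ 1 s) (by fun_prop) (by linarith)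
          (e0.sub e1),
        (tendsto_fst (g := (𝓝[>] 0 ×ˢ 𝓝 fun i => toLInf (j i)))).eventually
          ((by fun_prop : ContinuousAt (fun s => -γ 0 s - |γ 1 s|) s).eventually
            (lt_mem_nhds (by simp [h, h'] : (0 : ℝ) < -γ 0 s - |γ 1 s|)))] with z hz h2 h3 h4
      rw [normalisedEstimate, target, sdiff_eq_right (b := γ 1 z.1) (by linarith),
        sdiff_eq_right]
      · ring
      · rw [abs_le]; constructor <;> linarith
    · exact absurd ⟨h', h⟩ h0
    · rw [H, signs_of_right_zero_of_pos h h']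
      refine e1.neg.congr' ?_
      filter_upwards [hP,
        eventually_lt_inv_mul (g := fun s => γ 0 s - γ 1 s) (by fun_prop) (by linarith)
          (e1.sub e0),
        eventually_lt_inv_mul (g := fun s => γ 0 s + γ 1 s) (by fun_prop) (by linarith)
          (e1.add e0).neg,
        (tendsto_fst (g := (𝓝[>] 0 ×ˢ 𝓝 fun i => toLInf (j i)))).eventually
          ((by fun_prop : ContinuousAt (fun s => γ 0 s - |γ 1 s|) s).eventually
            (lt_mem_nhds (by simp [h, h'] : (0 : ℝ) < γ 0 s - |γ 1 s|)))] with z hz h2 h3 h4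
      rw [normalisedEstimate, target, sdiff_eq_neg_right (b := γ 1 z.1) (by linarith),
        sdiff_eq_neg_right]
      · ring
      · rw [abs_le]; constructor <;> linarith

/-- On the zero set of the target, the normalised estimates converge pointwise to `H`. -/
theorem tendsto_normalisedEstimate (γ j : Fin 2 → C(S, ℝ)) {s : S} (hs : s ∈ zeroSet γ) :
    Tendsto (fun z : ℝ × (Fin 2 → LInf S) => normalisedEstimate γ z.1 z.2 s)
      (𝓝[>] 0 ×ˢ 𝓝 fun i => toLInf (j i)) (𝓝 (H γ j s)) := by
  have hmk : Tendsto (fun z : ℝ × (Fin 2 → LInf S) => (s, z))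
      (𝓝[>] 0 ×ˢ 𝓝 fun i => toLInf (j i)) (𝓝 s ×ˢ (𝓝[>] 0 ×ˢ 𝓝 fun i => toLInf (j i))) :=
    tendsto_const_nhds.prodMk tendsto_id
  by_cases h0 : s ∈ V γ (0, 0)
  · obtain ⟨g0, g1⟩ := mem_V_zero.1 h0
    rw [H_of_zero j g0 g1]
    have e := (continuous_sdiff.tendsto (j 0 s, j 1 s)).comp
      (((tendsto_eval_toLInf j 0 s).comp hmk).prodMk_nhds ((tendsto_eval_toLInf j 1 s).comp hmk))
    refine e.congr fun z => ?_
    simp [normalisedEstimate, g0, g1]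
  · refine ((tendsto_normalisedEstimate_sub γ j hs h0).comp hmk).congr fun z => ?_
    simp [show target γ s = 0 from hs]

/-- If errors near `j` at small scales frequently give the inclusions, then the limit statistic at
`j` is at most `q`. -/
theorem limitStat_le_of_frequently (γ j : Fin 2 → C(S, ℝ)) {q : ℝ}
    (h : ∃ᶠ z : ℝ × (Fin 2 → LInf S) in 𝓝[>] 0 ×ˢ 𝓝 fun i => toLInf (j i),
      z.2 ∈ inclusionErrors γ q z.1) :
    limitStat γ j ≤ q := by
  rw [limitStat_eq, supOn_le_iff]
  intro s hs
  rw [EReal.coe_le_coe_iff, abs_le, ← Set.mem_Icc]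
  refine isClosed_Icc.mem_of_frequently_of_tendsto (h.mono fun z hz => ?_)
    (tendsto_normalisedEstimate γ j hs)
  have hs' : target γ s = 0 := hs
  exact ⟨(hz s).1 hs'.ge, (hz s).2 hs'.le⟩

/-- If the limit statistic at `j` is less than `q`, and the suprema of `U`, `-L` over the zero set
agree with those of `H`, `-H`, then errors near `j` at small scales give the inclusions. -/
theorem eventually_mem_inclusionErrors {γ j : Fin 2 → C(S, ℝ)} {q : ℝ}
    (hS1 : CondS1 γ ∨ CondBall γ)
    (hL : supOn (zeroSet γ) (fun s => -(L γ j s)) = supOn (zeroSet γ) (fun s => -(H γ j s)))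
    (hU : supOn (zeroSet γ) (fun s => U γ j s) = supOn (zeroSet γ) (fun s => H γ j s))
    (hq : limitStat γ j < q) :
    ∀ᶠ z : ℝ × (Fin 2 → LInf S) in 𝓝[>] 0 ×ˢ 𝓝 fun i => toLInf (j i),
      z.2 ∈ inclusionErrors γ q z.1 := by
  rw [limitStat_eq] at hq
  have hle := fun s hs => (supOn_le_iff.1 (le_refl (supOn (zeroSet γ) fun s => |H γ j s|))) s hs
  have hUq : ∀ s ∈ zeroSet γ, U γ j s < q := by
    have : supOn (zeroSet γ) (fun s => U γ j s) ≤ supOn (zeroSet γ) fun s => |H γ j s| := by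
      rw [hU, supOn_le_iff]
      exact fun s hs => (EReal.coe_le_coe_iff.2 (le_abs_self _)).trans (hle s hs)
    exact fun s hs => EReal.coe_lt_coe_iff.1 ((supOn_le_iff.1 this s hs).trans_lt hq)
  have hLq : ∀ s ∈ zeroSet γ, -L γ j s < q := by
    have : supOn (zeroSet γ) (fun s => -L γ j s) ≤ supOn (zeroSet γ) fun s => |H γ j s| := by
      rw [hL, supOn_le_iff]
      exact fun s hs => (EReal.coe_le_coe_iff.2 (neg_le_abs _)).trans (hle s hs)
    exact fun s hs => EReal.coe_lt_coe_iff.1 ((supOn_le_iff.1 this s hs).trans_lt hq)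
  have hloc : ∀ s : S, ∀ᶠ z : S × (ℝ × (Fin 2 → LInf S)) in
      𝓝 s ×ˢ (𝓝[>] 0 ×ˢ 𝓝 fun i => toLInf (j i)),
      (0 ≤ target γ z.1 → -q ≤ normalisedEstimate γ z.2.1 z.2.2 z.1) ∧
        (target γ z.1 ≤ 0 → normalisedEstimate γ z.2.1 z.2.2 z.1 ≤ q) := by
    intro s
    have hP := eventually_pos_scale s (𝓝 fun i => toLInf (j i))
    have emax := (tendsto_eval_toLInf j 0 s).abs.max (tendsto_eval_toLInf j 1 s).abs
    have ct : Continuous (target γ) :=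
      continuous_sdiff.comp ((γ 0).continuous.prodMk (γ 1).continuous)
    by_cases hs : s ∈ zeroSet γ
    -- Removing the scaled target is harmless: under each premise its sign pushes the estimate away
    -- from the bound to be proved.
    · suffices h : ∀ᶠ z : S × (ℝ × (Fin 2 → LInf S)) in
          𝓝 s ×ˢ (𝓝[>] 0 ×ˢ 𝓝 fun i => toLInf (j i)),
          |normalisedEstimate γ z.2.1 z.2.2 z.1 - z.2.1⁻¹ * target γ z.1| < q by
        filter_upwards [hP, h] with z hz hzq
        obtain ⟨h1, h2⟩ := abs_lt.1 hzq
        refine ⟨fun h => ?_, fun h => ?_⟩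
        · have := mul_nonneg (inv_pos.2 hz).le h
          linarith
        · have := mul_nonpos_of_nonneg_of_nonpos (inv_pos.2 hz).le h
          linarith
      have hHq : s ∉ N γ → |H γ j s| < q := by
        intro hN
        have h1 := hUq s hs
        have h2 := hLq s hs
        rw [U, if_neg hN] at h1
        rw [L, if_neg hN] at h2
        exact abs_lt.2 ⟨by linarith, h1⟩
      by_cases h0 : s ∈ V γ (0, 0)
      · by_cases hN : s ∈ N γ
        · have h1 := hUq s hs
          rw [U, if_pos hN] at h1
          filter_upwards [hP, emax.eventually_lt_const h1] with z hz h2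
          exact (abs_normalisedEstimate_sub_le hz _ _).trans_lt h2
        · have h1 := hHq hN
          obtain ⟨g0, g1⟩ := mem_V_zero.1 h0
          rw [H_of_zero j g0 g1] at h1
          have e := ((continuous_sdiff.tendsto (j 0 s, j 1 s)).comp
            ((tendsto_eval_toLInf j 0 s).prodMk_nhds (tendsto_eval_toLInf j 1 s))).abs
          -- Both signals vanish on a whole neighbourhood, so the estimate there is `sdiff` of the
          -- errors alone.
          filter_upwards [e.eventually_lt_const h1,
            (tendsto_fst (g := (𝓝[>] 0 ×ˢ 𝓝 fun i => toLInf (j i)))).eventually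
              (eventually_mem_V_zero hS1 h0 hN)] with z h2 h3
          obtain ⟨g0, g1⟩ := mem_V_zero.1 h3
          rw [normalisedEstimate, target, g0, g1, sdiff_zero_left]
          simpa using h2
      · have hN : s ∉ N γ := by
          intro hN
          obtain ⟨κ, -, h, -⟩ := Set.mem_iUnion₂.1 hN
          exact h0 h
        exact (tendsto_normalisedEstimate_sub γ j hs h0).abs.eventually_lt_const (hHq hN)
    · rcases lt_or_gt_of_ne (show target γ s ≠ 0 from hs) with h | h
      -- Off the zero set the target keeps its sign nearby, and its scaled value outweighs both the
      -- bounded errors and `q`, whatever the sign of `q`.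
      · filter_upwards [hP, tendsto_fst.eventually (ct.continuousAt.eventually (gt_mem_nhds h)),
          eventually_lt_inv_mul (g := fun s => -target γ s) (by fun_prop) (by linarith)
            (emax.sub_const q)] with z hz h1 h2
        have h3 := abs_le.1 (abs_normalisedEstimate_sub_le (γ := γ) hz z.2.2 z.1)
        exact ⟨fun h4 => absurd h4 (not_le.2 h1), fun _ => by linarith [h3.2]⟩
      · filter_upwards [hP, tendsto_fst.eventually (ct.continuousAt.eventually (lt_mem_nhds h)),
          eventually_lt_inv_mul (g := target γ) ct.continuousAt h
            (emax.sub_const q)] with z hz h1 h2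
        have h3 := abs_le.1 (abs_normalisedEstimate_sub_le (γ := γ) hz z.2.2 z.1)
        exact ⟨fun _ => by linarith [h3.1], fun h4 => absurd h4 (not_le.2 h1)⟩
  -- Tube lemma: finitely many local neighbourhoods yield one neighbourhood of scales and errors
  -- valid for every location.
  have hK := (isCompact_univ (X := S)).mem_nhdsSet_prod_of_forall fun s _ => hloc s
  rw [nhdsSet_univ, Filter.mem_prod_iff] at hK
  obtain ⟨A, hA, B, hB, hAB⟩ := hK
  filter_upwards [hB] with z hz s
  exact hAB (Set.mk_mem_prod (Filter.mem_top.1 hA ▸ Set.mem_univ s) hz)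

end Local

/-! ### The portmanteau theorem for arbitrary maps -/

section Portmanteau

variable {Ω : Type*} [MeasurableSpace Ω] {P : Measure Ω} [IsProbabilityMeasure P]

/-- Markov's inequality at level 1 for each majorant. The constant `C` is itself a majorant, so the
infimum is over a nonempty set. -/
theorem measure_real_le_outerExpectation {B : Set Ω} {T : Ω → ℝ} {C : ℝ} (h0 : ∀ ω, 0 ≤ T ω)
    (hC : ∀ ω, T ω ≤ C) (hB : ∀ ω ∈ B, 1 ≤ T ω) : P.real B ≤ outerExpectation P T := by
  refine le_csInf ⟨_, fun _ => C, measurable_const, integrable_const C, hC, rfl⟩ ?_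
  rintro e ⟨W, -, hi, hTW, rfl⟩
  have hmk := mul_meas_ge_le_integral_of_nonneg
    (Eventually.of_forall fun ω => (h0 ω).trans (hTW ω)) hi 1
  rw [one_mul] at hmk
  exact (measureReal_mono fun ω hω => (hB ω hω).trans (hTW ω)).trans hmk

variable {D : Type*} [PseudoEMetricSpace D] {X : ℕ → Ω → D} {Y : Ω → D}

/-- Closed sets: the limit superior of the outer probabilities is at most the limit probability. -/
theorem ConvergesWeakly.eventually_lt_of_isClosed (h : ConvergesWeakly P X Y) {F : Set D}
    (hF : IsClosed F) {c : ℝ} (hc : P.real (Y ⁻¹' F) < c) :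
    ∀ᶠ n in atTop, P.real (X n ⁻¹' F) < c := by
  borelize D
  obtain ⟨hY, hlim⟩ := h
  have hpos : ∀ n : ℕ, (0 : ℝ) < 1 / (n + 1) := fun n => Nat.one_div_pos_of_nat
  have hY' : Measurable Y := hY
  have := Measure.isProbabilityMeasure_map (μ := P) hY'.aemeasurable
  have h1 := tendsto_integral_thickenedIndicator_of_isClosed (P.map Y) hF hpos
    tendsto_one_div_add_atTop_nhds_zero_nat
  rw [map_measureReal_apply hY' hF.measurableSet] at h1
  -- The strict gap below `c` lets one fixed continuous majorant of the indicator of `F` serve for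
  -- all `n`.
  obtain ⟨m, hm⟩ := (h1.eventually_lt_const hc).exists
  let f : BoundedContinuousFunction D ℝ :=
    BoundedContinuousFunction.mkOfBound
      ⟨fun x => (thickenedIndicator (hpos m) F x : ℝ), by fun_prop⟩ 1 (by
        intro x y
        have hx := thickenedIndicator_le_one (hpos m) F x
        have hy := thickenedIndicator_le_one (hpos m) F y
        rw [Real.dist_eq, abs_le]
        have hx' : (thickenedIndicator (hpos m) F x : ℝ) ≤ 1 := by exact_mod_cast hx
        have hy' : (thickenedIndicator (hpos m) F y : ℝ) ≤ 1 := by exact_mod_cast hy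
        have hx0 := (thickenedIndicator (hpos m) F x).coe_nonneg
        have hy0 := (thickenedIndicator (hpos m) F y).coe_nonneg
        constructor <;> simp only [ContinuousMap.coe_mk] <;> linarith)
  have hf : ∀ x, f x = (thickenedIndicator (hpos m) F x : ℝ) := fun x => rfl
  have h2 : ∫ ω, f (Y ω) ∂P < c := by
    rw [← integral_map hY'.aemeasurable
      f.continuous.measurable.stronglyMeasurable.aestronglyMeasurable]
    exact hm
  filter_upwards [(hlim f).eventually_lt_const h2] with n hn
  refine (measure_real_le_outerExpectation (C := 1) (fun ω => ?_) (fun ω => ?_)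
    fun ω hω => ?_).trans_lt hn
  · rw [hf]; exact NNReal.coe_nonneg _
  · rw [hf]; exact_mod_cast thickenedIndicator_le_one (hpos m) F _
  · rw [hf, thickenedIndicator_one (hpos m) F hω, NNReal.coe_one]

/-- Varying sets: the outer probabilities of `X n ∈ A n` are asymptotically at most the probability
that `Y` is a limit of points of the sets `A n`. -/
theorem ConvergesWeakly.eventually_lt (h : ConvergesWeakly P X Y) (A : ℕ → Set D) {c : ℝ}
    (hc : P.real (Y ⁻¹' ⋂ k, closure (⋃ n ≥ k, A n)) < c) :
    ∀ᶠ n in atTop, P.real (X n ⁻¹' A n) < c := by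
  borelize D
  have hY : Measurable Y := h.1
  have hanti : Antitone fun k => Y ⁻¹' closure (⋃ n ≥ k, A n) := fun k l hkl =>
    Set.preimage_mono (closure_mono
      (Set.biUnion_subset_biUnion_left fun n (hn : l ≤ n) => hkl.trans hn))
  have h1 := tendsto_measure_iInter_atTop (μ := P)
    (fun k => (hY (isClosed_closure (s := ⋃ n ≥ k, A n)).measurableSet).nullMeasurableSet) hanti
    ⟨0, measure_ne_top _ _⟩
  have h2 := (ENNReal.tendsto_toReal (measure_ne_top _ _)).comp h1
  rw [Set.preimage_iInter] at hc
  obtain ⟨k, hk⟩ := (h2.eventually_lt_const hc).exists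
  filter_upwards [h.eventually_lt_of_isClosed isClosed_closure hk, eventually_ge_atTop k]
    with n hn hkn
  exact (measureReal_mono (Set.preimage_mono ((Set.subset_biUnion_of_mem
    (u := fun n => A n) (show n ∈ {n | n ≥ k} from hkn)).trans subset_closure))).trans_lt hn

/-- A limit of points of the sets `A n` is frequently approximated by them. -/
theorem frequently_of_mem_iInter_closure {A : ℕ → Set D} {y : D}
    (hy : y ∈ ⋂ k, closure (⋃ n ≥ k, A n)) : ∃ᶠ z : ℕ × D in atTop ×ˢ 𝓝 y, z.2 ∈ A z.1 := by
  intro hcon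
  obtain ⟨p, hp, r, hr, hpr⟩ := Filter.eventually_prod_iff.1 hcon
  obtain ⟨k, hk⟩ := eventually_atTop.1 hp
  obtain ⟨x, hx, hxA⟩ := mem_closure_iff_nhds.1 (Set.mem_iInter.1 hy k) _ hr
  obtain ⟨n, hn, hxn⟩ := Set.mem_iUnion₂.1 hxA
  exact hpr (hk n hn) hx hxn

end Portmanteau

/-- The event that the limit statistic is at most `q` is measurable. -/
theorem measurableSet_limitStat_le {S : Type*} [MetricSpace S] [CompactSpace S] {Ω : Type*}
    [MeasurableSpace Ω] {γ : Fin 2 → C(S, ℝ)} {J : Ω → Fin 2 → C(S, ℝ)}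
    (hJ : @Measurable Ω (Fin 2 → LInf S) _ (borel _) fun ω i => toLInf (J ω i)) (q : ℝ) :
    MeasurableSet {ω | limitStat γ (J ω) ≤ (q : EReal)} := by
  borelize (Fin 2 → LInf S)
  have hev : ∀ i s, Continuous fun x : Fin 2 → LInf S => x i s := fun i s =>
    ((continuous_apply s).comp
      (lp.uniformContinuous_coe (E := fun _ : S => ℝ) (p := ∞)).continuous).comp
      (continuous_apply i)
  -- Being an intersection of closed conditions, one per location, the set is closed even if the
  -- suprema run over uncountable sets.
  have hcl : IsClosed {x : Fin 2 → LInf S | (∀ s ∈ R γ 0, |x 0 s| ≤ q) ∧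
      (∀ s ∈ R γ 1, |x 1 s| ≤ q) ∧ ∀ s ∈ V γ (0, 0), |sdiff (x 0 s) (x 1 s)| ≤ q} := by
    simp only [Set.ofPred_and, Set.ofPred_forall]
    refine IsClosed.inter ?_ (IsClosed.inter ?_ ?_) <;>
      refine isClosed_iInter fun s => isClosed_iInter fun _ => isClosed_le ?_ continuous_const
    · exact (hev 0 s).abs
    · exact (hev 1 s).abs
    · exact (continuous_sdiff.comp ((hev 0 s).prodMk (hev 1 s))).abs
  convert hJ hcl.measurableSet using 1
  ext ω
  simp only [limitStat, max_le_iff, supOn_le_iff, EReal.coe_le_coe_iff, Set.mem_ofPred_eq,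
    Set.mem_preimage, and_assoc]
  rfl

end SymDiffCR

theorem mainTheorem12
    {S : Type*} [MetricSpace S] [CompactSpace S]
    {Ω : Type*} [MeasurableSpace Ω] (P : Measure Ω) [IsProbabilityMeasure P]
    (γ : Fin 2 → C(S, ℝ))
    (γhat : ℕ → Ω → Fin 2 → LInf S)
    (J : Ω → Fin 2 → C(S, ℝ))
    (τ : ℕ → ℝ) (hτ_pos : ∀ n, 0 < τ n) (hτ_lim : Tendsto τ atTop (𝓝 0))
    (hfCLT : ConvergesWeakly P (fun n ω => normalisedError γ (τ n) (γhat n ω))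
      (fun ω i => toLInf (J ω i)))
    (q : ℝ)
    (hS1 : CondS1 γ ∨ CondBall γ)
    (hS2_lower : ∀ᵐ ω ∂P, supOn (zeroSet γ) (fun s => -(L γ (J ω) s)) =
      supOn (zeroSet γ) (fun s => -(H γ (J ω) s)))
    (hS2_upper : ∀ᵐ ω ∂P, supOn (zeroSet γ) (fun s => U γ (J ω) s) =
      supOn (zeroSet γ) (fun s => H γ (J ω) s))
    (hS3 : P {ω | limitStat γ (J ω) = (q : EReal)} = 0) :
    Tendsto (fun n => innerProb P (inclusionEvent γ (τ n) q (γhat n))) atTop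
        (𝓝 (P {ω | limitStat γ (J ω) ≤ (q : EReal)})) ∧
      Tendsto (fun n => outerProb P (inclusionEvent γ (τ n) q (γhat n))) atTop
        (𝓝 (P {ω | limitStat γ (J ω) ≤ (q : EReal)})) := by
  have hτ : Tendsto τ atTop (𝓝[>] 0) :=
    tendsto_nhdsWithin_iff.2 ⟨hτ_lim, Eventually.of_forall hτ_pos⟩
  set M : Set Ω := {ω | limitStat γ (J ω) ≤ (q : EReal)} with hM
  have hMm : MeasurableSet M := measurableSet_limitStat_le hfCLT.1 q
  set E : ℕ → Set Ω := fun n => inclusionEvent γ (τ n) q (γhat n)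
  have hE : ∀ n, E n = (fun ω => normalisedError γ (τ n) (γhat n ω)) ⁻¹'
      inclusionErrors γ q (τ n) := fun n => inclusionEvent_eq γ (hτ_pos n) q (γhat n)
  have hmap : ∀ y : Fin 2 → LInf S, Tendsto (fun z : ℕ × (Fin 2 → LInf S) => (τ z.1, z.2))
      (atTop ×ˢ 𝓝 y) (𝓝[>] 0 ×ˢ 𝓝 y) := fun y => hτ.prodMap tendsto_id
  have hup : ∀ c, P.real M < c → ∀ᶠ n in atTop, P.real (E n) < c := by
    intro c hc
    simp only [hE]
    refine hfCLT.eventually_lt (fun n => inclusionErrors γ q (τ n))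
      ((measureReal_mono fun ω hω => ?_).trans_lt hc)
    exact limitStat_le_of_frequently γ (J ω)
      ((hmap _).frequently (frequently_of_mem_iInter_closure hω))
  have hlow : ∀ c, P.real Mᶜ < c → ∀ᶠ n in atTop, P.real (E n)ᶜ < c := by
    intro c hc
    simp only [hE, ← Set.preimage_compl]
    refine hfCLT.eventually_lt (fun n => (inclusionErrors γ q (τ n))ᶜ) (lt_of_le_of_lt ?_ hc)
    refine ENNReal.toReal_mono (measure_ne_top _ _) (measure_mono_ae ?_)
    have hS3' : ∀ᵐ ω ∂P, limitStat γ (J ω) ≠ (q : EReal) := by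
      simpa [ae_iff] using hS3
    filter_upwards [hS2_lower, hS2_upper, hS3'] with ω h1 h2 h3 hω hle
    have hev := eventually_mem_inclusionErrors hS1 h1 h2 (lt_of_le_of_ne hle h3)
    exact (frequently_of_mem_iInter_closure hω)
      (((hmap _).eventually hev).mono fun z hz => not_not.2 hz)
  have hout : ∀ n, outerProb P (E n) = ENNReal.ofReal (P.real (E n)) := fun n => by
    rw [outerProb_eq, ofReal_measureReal]
  have hinn : ∀ n, innerProb P (E n) = ENNReal.ofReal (1 - P.real (E n)ᶜ) := fun n => by
    rw [innerProb, outerProb_eq, ENNReal.ofReal_sub _ measureReal_nonneg, ofReal_measureReal,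
      ENNReal.ofReal_one]
  -- Inner probability is at most outer probability, by subadditivity alone. The two bounds `hup`
  -- and `hlow` therefore squeeze both.
  have hcompl : ∀ n, 1 - P.real (E n)ᶜ ≤ P.real (E n) := fun n => by
    have := measureReal_union_le (μ := P) (E n) (E n)ᶜ
    rw [Set.union_compl_self, probReal_univ] at this
    linarith
  have hMc : P.real Mᶜ = 1 - P.real M := probReal_compl_eq_one_sub hMm
  have hPM : P M = ENNReal.ofReal (P.real M) := (ofReal_measureReal).symm
  have hlow' : ∀ c, c < P.real M → ∀ᶠ n in atTop, c < 1 - P.real (E n)ᶜ := fun c hc =>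
    (hlow (1 - c) (by linarith)).mono fun n hn => by linarith
  change Tendsto (fun n => innerProb P (E n)) atTop (𝓝 (P M)) ∧
    Tendsto (fun n => outerProb P (E n)) atTop (𝓝 (P M))
  simp only [hout, hinn, hPM]
  refine ⟨ENNReal.tendsto_ofReal (tendsto_order.2 ⟨hlow', fun c hc => ?_⟩),
    ENNReal.tendsto_ofReal (tendsto_order.2 ⟨fun c hc => ?_, hup⟩)⟩
  · exact (hup c hc).mono fun n hn => (hcompl n).trans_lt hn
  · exact (hlow' c hc).mono fun n hn => hn.trans_le (hcompl n)
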